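/- \textbf{Lemma.} Let $\sigma>0$, and let $T\colon L_2([-1,1])\to L_2([-1,1])$ be the integral operator $$T[\phi](x)=\int_{-1}^{1}e^{-\sigma^2(x-y)^2}\,\phi(y)\,dy$$ on the space of real-valued square-integrable functions on $[-1,1]$ with Lebesgue measure. Let $\lambda_1\ge\lambda_2\ge\cdots$ be the positive eigenvalues of $T$, in decreasing order and counted with multiplicity. Then, for every integer $k\ge 1$, $$\lambda_k<8\cdot\Big(\frac{2}{e}(k-1)\Big)^{-\frac{k-1}{2}}\sigma^{k-1},$$ where $0^0=1$ when $k=1$. -/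

import Mathlib

open MeasureTheory

/-- The Gaussian kernel `exp (-σ² (x - y)²)` in one dimension. -/
noncomputable def gaussianKernel (σ x y : ℝ) : ℝ :=
  Real.exp (-σ ^ 2 * (x - y) ^ 2)

/-- Lebesgue measure on the interval `[-1, 1]`. -/
noncomputable def lebesgueInterval : Measure ℝ :=
  volume.restrict (Set.Icc (-1 : ℝ) 1)

instance lebesgueInterval_isFiniteMeasure : IsFiniteMeasure lebesgueInterval := by
  unfold lebesgueInterval
  infer_instance

/-- The Hilbert space `L₂([-1, 1])` of real-valued square-integrable functions. -/
abbrev L2Interval : Type := Lp ℝ 2 lebesgueInterval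

theorem gaussianKernel_continuous (σ : ℝ) :
    Continuous (fun p : ℝ × ℝ => gaussianKernel σ p.1 p.2) := by
  unfold gaussianKernel
  fun_prop

theorem gaussianKernel_norm_le_one (σ x y : ℝ) : ‖gaussianKernel σ x y‖ ≤ 1 := by
  unfold gaussianKernel
  rw [Real.norm_eq_abs, abs_of_pos (Real.exp_pos _), Real.exp_le_one_iff]
  have h := mul_nonneg (sq_nonneg σ) (sq_nonneg (x - y))
  linarith

theorem L2Interval_integrable (φ : L2Interval) : Integrable φ lebesgueInterval :=
  (Lp.memLp φ).integrable one_le_two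

theorem gaussianKernel_mul_integrable (σ x : ℝ) (φ : L2Interval) :
    Integrable (fun y => gaussianKernel σ x y * φ y) lebesgueInterval := by
  refine (L2Interval_integrable φ).bdd_mul (c := 1) ?_ ?_
  · exact ((gaussianKernel_continuous σ).comp
      (Continuous.prodMk_right x)).aestronglyMeasurable
  · exact Filter.Eventually.of_forall fun y => gaussianKernel_norm_le_one σ x y

theorem gaussianIntegral_memLp (σ : ℝ) (φ : L2Interval) :
    MemLp (fun x => ∫ y, gaussianKernel σ x y * φ y ∂lebesgueInterval) 2
      lebesgueInterval := by
  refine MemLp.of_bound (C := ∫ y, ‖φ y‖ ∂lebesgueInterval) ?_ ?_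
  · have h : AEStronglyMeasurable
        (fun p : ℝ × ℝ => gaussianKernel σ p.1 p.2 * φ p.2)
        (lebesgueInterval.prod lebesgueInterval) :=
      (gaussianKernel_continuous σ).aestronglyMeasurable.mul
        (Lp.aestronglyMeasurable φ).comp_snd
    exact h.integral_prod_right'
  · refine Filter.Eventually.of_forall fun x => ?_
    refine norm_integral_le_of_norm_le (L2Interval_integrable φ).norm
      (Filter.Eventually.of_forall fun y => ?_)
    rw [norm_mul]
    exact mul_le_of_le_one_left (norm_nonneg _) (gaussianKernel_norm_le_one σ x y)

/-- The integral operator `T : L₂([-1, 1]) → L₂([-1, 1])`,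
`T[φ](x) = ∫_{-1}^{1} exp (-σ² (x - y)²) φ(y) dy`. -/
noncomputable def gaussianOperator (σ : ℝ) : L2Interval →ₗ[ℝ] L2Interval where
  toFun φ := (gaussianIntegral_memLp σ φ).toLp
    (fun x => ∫ y, gaussianKernel σ x y * φ y ∂lebesgueInterval)
  map_add' φ ψ := by
    rw [← MemLp.toLp_add]
    refine MemLp.toLp_congr _ _ (Filter.Eventually.of_forall fun x => ?_)
    simp only [Pi.add_apply]
    rw [← integral_add (gaussianKernel_mul_integrable σ x φ)
      (gaussianKernel_mul_integrable σ x ψ)]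
    refine integral_congr_ae ?_
    filter_upwards [Lp.coeFn_add φ ψ] with y hy
    rw [hy, Pi.add_apply, mul_add]
  map_smul' c φ := by
    rw [RingHom.id_apply, ← MemLp.toLp_const_smul]
    refine MemLp.toLp_congr _ _ (Filter.Eventually.of_forall fun x => ?_)
    simp only [Pi.smul_apply, smul_eq_mul]
    rw [← integral_const_mul]
    refine integral_congr_ae ?_
    filter_upwards [Lp.coeFn_smul c φ] with y hy
    rw [hy, Pi.smul_apply, smul_eq_mul, mul_left_comm]

/-- The `k`-th largest eigenvalue (`k = 1, 2, …`), counted with multiplicity, of a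
compact positive self-adjoint operator `T`: the largest `μ > 0` such that the
eigenspaces of `T` for eigenvalues `ν ≥ μ` have total dimension at least `k`.
As usual it is `0` if `T` has fewer than `k` positive eigenvalues. -/
noncomputable def orderedEigenvalue {V : Type*} [AddCommGroup V] [Module ℝ V]
    (T : Module.End ℝ V) (k : ℕ) : ℝ :=
  sSup {μ : ℝ | 0 < μ ∧
    (k : Cardinal) ≤ Module.rank ℝ ↥(⨆ ν ∈ Set.Ici μ, T.eigenspace ν)}

/-! Write `k = n + 1` and replace each section `K(x, ·)` of the kernel by its interpolant at the `n`
Chebyshev nodes. The interpolants lie in the span of `n` Lagrange basis polynomials, so for `φ`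
orthogonal to these only the interpolation error `K - P` contributes to `T φ`. If that error is at
most `M`, then `⟪T φ, φ⟫ ≤ M (∫ |φ|)² ≤ 2 M ‖φ‖²`. A sum of eigenspaces of dimension at least `k`
meets this space of codimension at most `n`, which bounds the `k`-th eigenvalue by `2 M`.

To find `M`, the Gaussian is written as a Gaussian average of the cosines `cos (2σu(y - x))`, whose
`n`-th derivatives are at most `|2σu|ⁿ`. Averaging produces the moment `Γ((n + 1)/2)`; Legendre
duplication and `Γ(m + 1) ≥ (m/e)^m` turn it into the stated power. -/

/-! ### Lagrange interpolation error -/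

/-- Iterated Rolle theorem. -/
theorem exists_iteratedDeriv_eq_zero (n : ℕ) {f : ℝ → ℝ} (hf : ContDiff ℝ n f)
    {x : Fin (n + 1) → ℝ} (hx : StrictMono x) (h0 : ∀ i, f (x i) = 0) :
    ∃ ξ, iteratedDeriv n f ξ = 0 := by
  induction n generalizing f with
  | zero => exact ⟨x 0, by simpa using h0 0⟩
  | succ n ih =>
    have hc : Continuous f := hf.continuous
    have hrolle (i : Fin (n + 1)) :
        ∃ c ∈ Set.Ioo (x i.castSucc) (x i.succ), deriv f c = 0 :=
      exists_deriv_eq_zero (hx i.castSucc_lt_succ) hc.continuousOn (by rw [h0, h0])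
    choose c hc hd using hrolle
    have hcm : StrictMono c := by
      refine fun i j hij => ((hc i).2.trans_le (hx.monotone ?_)).trans (hc j).1
      exact Fin.succ_le_castSucc_iff.mpr hij
    rw [iteratedDeriv_succ']
    refine ih ?_ hcm hd
    exact ((contDiff_succ_iff_deriv (n := (n : WithTop ℕ∞))).mp (by exact_mod_cast hf)).2.2

theorem Polynomial.iteratedDeriv_eval (p : Polynomial ℝ) (n : ℕ) :
    iteratedDeriv n (fun y => p.eval y) = fun y => (derivative^[n] p).eval y := by
  induction n with
  | zero => simp
  | succ n ih =>
    rw [iteratedDeriv_succ, ih, Function.iterate_succ_apply']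
    ext y
    exact Polynomial.deriv _

theorem Polynomial.Monic.iterate_derivative_natDegree {p : Polynomial ℝ} (hp : p.Monic) :
    derivative^[p.natDegree] p = C (p.natDegree.factorial : ℝ) := by
  have hd : (derivative^[p.natDegree] p).natDegree = 0 := by
    have := natDegree_iterate_derivative p p.natDegree
    omega
  rw [eq_C_of_natDegree_eq_zero hd, coeff_iterate_derivative]
  simp [hp.coeff_natDegree, Nat.descFactorial_self]

/-- Error bound for Lagrange interpolation. -/
theorem Lagrange.abs_sub_eval_interpolate_le (s : Finset ℝ) {f : ℝ → ℝ}
    (hf : ContDiff ℝ s.card f) {M : ℝ} (hM : ∀ y, |iteratedDeriv s.card f y| ≤ M) (y : ℝ) :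
    |f y - (Lagrange.interpolate s id f).eval y| ≤
      M / s.card.factorial * |(Lagrange.nodal s id).eval y| := by
  set P := Lagrange.interpolate s id f with hP
  set W := Lagrange.nodal s (id : ℝ → ℝ) with hW
  have hinj : Set.InjOn (id : ℝ → ℝ) s := Function.injective_id.injOn
  by_cases hy : y ∈ s
  · have h1 : P.eval y = f y := Lagrange.eval_interpolate_at_node f hinj hy
    have h2 : W.eval y = 0 := Lagrange.eval_nodal_at_node (v := (id : ℝ → ℝ)) hy
    simp [h1, h2]
  have hWy : W.eval y ≠ 0 := by
    rw [hW, Lagrange.eval_nodal, Finset.prod_ne_zero_iff]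
    intro i hi h
    exact hy (by rw [sub_eq_zero.mp h]; exact hi)
  -- This `c` makes `f - Q` vanish at `y` as well as on `s`: one zero more than the order of
  -- differentiation, as Rolle requires.
  set c := (f y - P.eval y) / W.eval y with hc
  set Q := P + Polynomial.C c * W with hQ
  have hQc : ContDiff ℝ s.card (fun z => Q.eval z) := by
    simpa using Q.contDiff_aeval (s.card : WithTop ℕ∞) (R := ℝ) (𝕜 := ℝ)
  set t := insert y s
  have ht : t.card = s.card + 1 := Finset.card_insert_of_notMem hy
  have hzero : ∀ i ∈ t, (f - fun z => Q.eval z) i = 0 := by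
    intro i hi
    rcases Finset.mem_insert.mp hi with rfl | hi
    · simp only [hQ, hc, Pi.sub_apply, Polynomial.eval_add, Polynomial.eval_mul,
        Polynomial.eval_C]
      field_simp
      ring
    · have h1 : P.eval i = f i := Lagrange.eval_interpolate_at_node f hinj hi
      have h2 : W.eval i = 0 := Lagrange.eval_nodal_at_node (v := (id : ℝ → ℝ)) hi
      simp [hQ, h1, h2]
  obtain ⟨ξ, hξ⟩ := exists_iteratedDeriv_eq_zero s.card (hf.sub hQc)
    (t.orderEmbOfFin ht).strictMono (fun i => hzero _ (t.orderEmbOfFin_mem ht i))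
  change iteratedDeriv s.card (f - fun z => Q.eval z) ξ = 0 at hξ
  rw [iteratedDeriv_sub hf.contDiffAt hQc.contDiffAt, Polynomial.iteratedDeriv_eval,
    sub_eq_zero] at hξ
  have hWd : W.natDegree = s.card := Lagrange.natDegree_nodal
  have hPd : Polynomial.derivative^[s.card] P = 0 := by
    rcases eq_or_ne P 0 with h | h
    · rw [h, Polynomial.iterate_derivative_zero]
    · apply Polynomial.iterate_derivative_eq_zero
      exact (Polynomial.natDegree_lt_iff_degree_lt h).mpr
        (Lagrange.degree_interpolate_lt f hinj)
  have hWn : Polynomial.derivative^[s.card] W = Polynomial.C (s.card.factorial : ℝ) := by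
    rw [← hWd]
    exact (Lagrange.nodal_monic (s := s) (v := (id : ℝ → ℝ))).iterate_derivative_natDegree
  have hval : iteratedDeriv s.card f ξ = c * s.card.factorial := by
    rw [hξ, hQ, iterate_map_add, Polynomial.iterate_derivative_C_mul, hPd,
      hWn]
    simp
  have hfac : (0 : ℝ) < s.card.factorial := by positivity
  have hcM : |c| ≤ M / s.card.factorial := by
    rw [le_div_iff₀ hfac, ← abs_of_pos hfac, ← abs_mul, ← hval]
    exact hM ξ
  calc |f y - P.eval y| = |c| * |W.eval y| := by
        rw [← abs_mul, hc, div_mul_cancel₀ _ hWy]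
    _ ≤ _ := by gcongr

/-! ### Chebyshev nodes -/

/-- The zeros of the `n`-th Chebyshev polynomial. -/
noncomputable def chebyshevNodes (n : ℕ) : Finset ℝ :=
  (Finset.range n).image fun k : ℕ => Real.cos ((2 * k + 1) * Real.pi / (2 * n))

theorem roots_T_eq_chebyshevNodes (n : ℕ) :
    (Polynomial.Chebyshev.T ℝ n).roots = (chebyshevNodes n).val :=
  Polynomial.Chebyshev.roots_T_real n

theorem card_chebyshevNodes (n : ℕ) : (chebyshevNodes n).card = n := by
  rw [chebyshevNodes, Finset.card_image_of_injOn, Finset.card_range]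
  exact (Finset.range n).nodup_map_iff_injOn.mp (Polynomial.Chebyshev.roots_T_real_nodup n)

theorem abs_eval_nodal_chebyshevNodes_le (n : ℕ) {y : ℝ} (hy : y ∈ Set.Icc (-1 : ℝ) 1) :
    |(Lagrange.nodal (chebyshevNodes n) id).eval y| ≤ 2 / 2 ^ n := by
  have hT := Polynomial.C_leadingCoeff_mul_prod_multiset_X_sub_C
    (p := Polynomial.Chebyshev.T ℝ n)
    (by rw [roots_T_eq_chebyshevNodes, Polynomial.Chebyshev.natDegree_T, Finset.card_val,
      card_chebyshevNodes, Int.natAbs_natCast])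
  have hT' : (2 : ℝ) ^ (n - 1) * (Lagrange.nodal (chebyshevNodes n) id).eval y =
      (Polynomial.Chebyshev.T ℝ n).eval y := by
    rw [← hT, Polynomial.Chebyshev.leadingCoeff_T, roots_T_eq_chebyshevNodes, Lagrange.nodal]
    simp only [Polynomial.eval_mul, Finset.prod, Int.natAbs_natCast, Polynomial.eval_C, id]
  have h1 : |(2 : ℝ) ^ (n - 1) * (Lagrange.nodal (chebyshevNodes n) id).eval y| ≤ 1 := by
    rw [hT']
    exact Polynomial.Chebyshev.abs_eval_T_real_le_one n (abs_le.mpr hy)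
  rw [abs_mul, abs_of_pos (by positivity)] at h1
  -- An equality except at `n = 0`, where the subtraction truncates.
  have h2 : (2 : ℝ) ^ n ≤ 2 * 2 ^ (n - 1) := by
    rw [← pow_succ']
    exact pow_le_pow_right₀ one_le_two (by omega)
  rw [le_div_iff₀ (by positivity)]
  calc _ ≤ |(Lagrange.nodal (chebyshevNodes n) id).eval y| * (2 * 2 ^ (n - 1)) := by gcongr
    _ ≤ 2 := by linarith

/-! ### The Gaussian as an average of cosines -/

theorem gaussianKernel_eq_integral (σ x y : ℝ) :
    gaussianKernel σ x y =
      (√Real.pi)⁻¹ * ∫ u, Real.exp (-u ^ 2) * Real.cos (2 * σ * u * (y - x)) := by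
  have h := fourierIntegral_gaussian (b := 1) (by simp) ((2 * σ * (y - x) : ℝ) : ℂ)
  have hr : ((Real.pi : ℂ) / 1) ^ (1 / 2 : ℂ) *
      Complex.exp (-((2 * σ * (y - x) : ℝ) : ℂ) ^ 2 / (4 * 1)) =
      ((√Real.pi * gaussianKernel σ x y : ℝ) : ℂ) := by
    rw [Complex.ofReal_mul (√Real.pi), Real.sqrt_eq_rpow, Complex.ofReal_cpow Real.pi_pos.le,
      gaussianKernel, Complex.ofReal_exp]
    push_cast
    congr 2
    · simp
    · ring
  rw [hr] at h
  have hpos : 0 < √Real.pi * gaussianKernel σ x y :=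
    mul_pos (Real.sqrt_pos.mpr Real.pi_pos) (Real.exp_pos _)
  -- A non-integrable function has integral `0` by convention, so a nonzero value gives
  -- integrability.
  have hint := Integrable.of_integral_ne_zero
    (by rw [h]; exact_mod_cast hpos.ne')
  have hre := Complex.reCLM.integral_comp_comm hint
  rw [h] at hre
  simp only [Complex.reCLM_apply, Complex.ofReal_re] at hre
  rw [eq_inv_mul_iff_mul_eq₀ (Real.sqrt_pos.mpr Real.pi_pos).ne', ← hre]
  refine integral_congr_ae (Filter.Eventually.of_forall fun u => ?_)
  have e1 : Complex.I * ((2 * σ * (y - x) : ℝ) : ℂ) * (u : ℂ) =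
      ((2 * σ * u * (y - x) : ℝ) : ℂ) * Complex.I := by
    push_cast
    ring
  have e2 : (-1 : ℂ) * (u : ℂ) ^ 2 = ((-u ^ 2 : ℝ) : ℂ) := by
    push_cast
    ring
  simp only [e1, e2]
  rw [← Complex.ofReal_exp, Complex.re_mul_ofReal, Complex.exp_ofReal_mul_I_re, mul_comm]

theorem integrable_abs_pow_mul_exp_neg_sq (n : ℕ) :
    Integrable fun u : ℝ => |u| ^ n * Real.exp (-u ^ 2) := by
  have h := (integrable_rpow_mul_exp_neg_mul_sq (b := 1) one_pos (s := (n : ℝ))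
    (by have : (0 : ℝ) ≤ n := n.cast_nonneg
        linarith)).norm
  refine h.congr (Filter.Eventually.of_forall fun u => ?_)
  simp [Real.abs_exp]

theorem integral_abs_pow_mul_exp_neg_sq (n : ℕ) :
    ∫ u : ℝ, |u| ^ n * Real.exp (-u ^ 2) = Real.Gamma (((n : ℝ) + 1) / 2) := by
  have h1 := integral_comp_abs (f := fun u : ℝ => u ^ n * Real.exp (-u ^ 2))
  simp only [sq_abs] at h1
  have h2 := integral_rpow_mul_exp_neg_rpow (p := 2) (q := (n : ℝ)) two_pos
    (by have : (0 : ℝ) ≤ n := n.cast_nonneg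
        linarith)
  simp only [Real.rpow_natCast, Real.rpow_ofNat] at h2
  rw [h1, h2]
  ring

theorem abs_cos_sub_interpolate_le (s : Finset ℝ) (a x y : ℝ) :
    |Real.cos (a * (y - x)) -
      (Lagrange.interpolate s id fun z => Real.cos (a * (z - x))).eval y| ≤
      |a| ^ s.card / s.card.factorial * |(Lagrange.nodal s id).eval y| := by
  have hc : ContDiff ℝ s.card fun z => Real.cos (a * (z - x)) :=
    Real.contDiff_cos.comp (contDiff_const.mul (contDiff_id.sub contDiff_const))
  refine Lagrange.abs_sub_eval_interpolate_le s hc (fun z => ?_) y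
  have h1 := congrFun (iteratedDeriv_comp_sub_const s.card (fun z => Real.cos (a * z)) x) z
  rw [iteratedDeriv_comp_const_mul Real.contDiff_cos] at h1
  rw [h1, abs_mul, abs_pow]
  exact mul_le_of_le_one_right (by positivity) (Real.abs_iteratedDeriv_cos_le_one _ _)

theorem abs_gaussianKernel_sub_interpolate_le (σ : ℝ) (s : Finset ℝ) (x y : ℝ) :
    |gaussianKernel σ x y - (Lagrange.interpolate s id (gaussianKernel σ x)).eval y| ≤
      (√Real.pi)⁻¹ * ((2 * |σ|) ^ s.card * Real.Gamma (((s.card : ℝ) + 1) / 2)) /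
        s.card.factorial * |(Lagrange.nodal s id).eval y| := by
  set W := |(Lagrange.nodal s id).eval y|
  have hint (z : ℝ) :
      Integrable fun u : ℝ => Real.exp (-u ^ 2) * Real.cos (2 * σ * u * (z - x)) := by
    have h := integrable_abs_pow_mul_exp_neg_sq 0
    simp only [pow_zero, one_mul] at h
    exact h.mul_bdd (c := 1) (by fun_prop)
      (Filter.Eventually.of_forall fun u => Real.abs_cos_le_one _)
  have heval (r : ℝ → ℝ) : (Lagrange.interpolate s id r).eval y =
      ∑ i ∈ s, r i * (Lagrange.basis s id i).eval y := by
    simp [Lagrange.interpolate_apply, Polynomial.eval_finsetSum]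
  -- Interpolation is a finite linear combination of nodal values, so it commutes with the average
  -- over `u`.
  have hrep : gaussianKernel σ x y -
      (Lagrange.interpolate s id (gaussianKernel σ x)).eval y =
      (√Real.pi)⁻¹ * ∫ u, Real.exp (-u ^ 2) * (Real.cos (2 * σ * u * (y - x)) -
        (Lagrange.interpolate s id fun z => Real.cos (2 * σ * u * (z - x))).eval y) := by
    simp only [heval, mul_sub (Real.exp _), Finset.mul_sum, ← mul_assoc (Real.exp _)]
    rw [integral_sub (hint y) (integrable_finsetSum _ fun i _ => (hint i).mul_const _),
      integral_finsetSum _ fun i _ => (hint i).mul_const _, mul_sub,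
      ← gaussianKernel_eq_integral, Finset.mul_sum]
    simp only [integral_mul_const, ← mul_assoc, ← gaussianKernel_eq_integral]
  rw [hrep, abs_mul, abs_of_pos (inv_pos.mpr (Real.sqrt_pos.mpr Real.pi_pos)), mul_div_assoc,
    mul_assoc]
  refine mul_le_mul_of_nonneg_left ?_ (by positivity)
  have hbound : ∀ u : ℝ, ‖Real.exp (-u ^ 2) * (Real.cos (2 * σ * u * (y - x)) -
        (Lagrange.interpolate s id fun z => Real.cos (2 * σ * u * (z - x))).eval y)‖ ≤
      (2 * |σ|) ^ s.card / s.card.factorial * W * (|u| ^ s.card * Real.exp (-u ^ 2)) := by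
    intro u
    rw [norm_mul, Real.norm_eq_abs, Real.abs_exp, Real.norm_eq_abs]
    refine (mul_le_mul_of_nonneg_left (abs_cos_sub_interpolate_le s (2 * σ * u) x y)
      (Real.exp_pos _).le).trans_eq ?_
    rw [abs_mul, abs_mul, abs_two, mul_pow]
    ring
  refine (norm_integral_le_of_norm_le
    ((integrable_abs_pow_mul_exp_neg_sq _).const_mul _)
    (Filter.Eventually.of_forall hbound)).trans_eq ?_
  rw [integral_const_mul, integral_abs_pow_mul_exp_neg_sq]
  ring

/-! ### Gamma function estimates and the explicit error -/

/-- Cut the Gamma integral down to `x > m`, where `x ^ m ≥ m ^ m`. -/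
theorem rpow_mul_exp_neg_le_Gamma {m : ℝ} (hm : 0 ≤ m) :
    m ^ m * Real.exp (-m) ≤ Real.Gamma (m + 1) := by
  rw [Real.Gamma_eq_integral (by linarith), ← integral_exp_neg_Ioi, ← integral_const_mul]
  have hint := Real.GammaIntegral_convergent (s := m + 1) (by linarith)
  simp only [add_sub_cancel_right] at hint ⊢
  calc ∫ x in Set.Ioi m, m ^ m * Real.exp (-x)
      ≤ ∫ x in Set.Ioi m, Real.exp (-x) * x ^ m := by
        refine setIntegral_mono_on ((integrableOn_exp_neg_Ioi m).const_mul _)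
          (hint.mono_set (Set.Ioi_subset_Ioi hm)) measurableSet_Ioi fun x hx => ?_
        rw [mul_comm]
        exact mul_le_mul_of_nonneg_left (Real.rpow_le_rpow hm (le_of_lt hx) hm)
          (Real.exp_pos _).le
    _ ≤ ∫ x in Set.Ioi 0, Real.exp (-x) * x ^ m := by
        refine setIntegral_mono_set hint ?_ (Set.Ioi_subset_Ioi hm).eventuallyLE
        refine (ae_restrict_iff' measurableSet_Ioi).mpr (Filter.Eventually.of_forall ?_)
        intro x hx
        exact mul_nonneg (Real.exp_pos _).le (Real.rpow_nonneg (le_of_lt hx) _)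

/-- Legendre duplication at half-integers. -/
theorem Gamma_half_eq (n : ℕ) :
    Real.Gamma (((n : ℝ) + 1) / 2) * Real.Gamma ((n : ℝ) / 2 + 1) * 2 ^ n =
      n.factorial * √Real.pi := by
  have h := Real.Gamma_mul_Gamma_add_half (((n : ℝ) + 1) / 2)
  rw [show ((n : ℝ) + 1) / 2 + 1 / 2 = n / 2 + 1 by ring,
    show 2 * (((n : ℝ) + 1) / 2) = n + 1 by ring, Real.Gamma_nat_eq_factorial,
    show (1 : ℝ) - (n + 1) = -n by ring, Real.rpow_neg two_pos.le, Real.rpow_natCast] at h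
  rw [h]
  field_simp

theorem inv_Gamma_half_le (n : ℕ) :
    (2 ^ n * Real.Gamma ((n : ℝ) / 2 + 1))⁻¹ ≤
      (2 / Real.exp 1 * (n : ℝ)) ^ (-(n : ℝ) / 2) := by
  have hm : (0 : ℝ) ≤ (n : ℝ) / 2 := by positivity
  have h := rpow_mul_exp_neg_le_Gamma hm
  have hpow : (2 / Real.exp 1 * (n : ℝ)) ^ ((n : ℝ) / 2) =
      2 ^ n * (((n : ℝ) / 2) ^ ((n : ℝ) / 2) * Real.exp (-((n : ℝ) / 2))) := by
    have e1 : 2 / Real.exp 1 * (n : ℝ) = 2 ^ (2 : ℝ) * ((n : ℝ) / 2 * Real.exp (-1)) := by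
      rw [Real.exp_neg, Real.rpow_two]
      field_simp
    rw [e1, Real.mul_rpow (by positivity) (by positivity), ← Real.rpow_mul two_pos.le,
      mul_div_cancel₀ _ two_ne_zero, Real.rpow_natCast,
      Real.mul_rpow hm (Real.exp_pos _).le, ← Real.exp_mul, neg_one_mul]
  have hpos : 0 < ((n : ℝ) / 2) ^ ((n : ℝ) / 2) := by
    rcases n.eq_zero_or_pos with rfl | hn
    · simp
    · positivity
  rw [neg_div, Real.rpow_neg (by positivity), hpow]
  gcongr

/-- Chebyshev interpolation of the Gaussian kernel. -/
theorem abs_gaussianKernel_sub_chebyshev_le {σ : ℝ} (hσ : 0 ≤ σ) (n : ℕ) (x : ℝ) {y : ℝ}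
    (hy : y ∈ Set.Icc (-1 : ℝ) 1) :
    |gaussianKernel σ x y -
      (Lagrange.interpolate (chebyshevNodes n) id (gaussianKernel σ x)).eval y| ≤
      2 * (2 / Real.exp 1 * (n : ℝ)) ^ (-(n : ℝ) / 2) * σ ^ n := by
  have h := abs_gaussianKernel_sub_interpolate_le σ (chebyshevNodes n) x y
  rw [card_chebyshevNodes, abs_of_nonneg hσ] at h
  have hG : 0 < Real.Gamma (((n : ℝ) + 1) / 2) := Real.Gamma_pos_of_pos (by positivity)
  have hG' : 0 < Real.Gamma ((n : ℝ) / 2 + 1) := Real.Gamma_pos_of_pos (by positivity)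
  have hπ : 0 < √Real.pi := Real.sqrt_pos.mpr Real.pi_pos
  calc _ ≤ _ := h
    _ ≤ (√Real.pi)⁻¹ * ((2 * σ) ^ n * Real.Gamma (((n : ℝ) + 1) / 2)) / n.factorial *
        (2 / 2 ^ n) := by
      gcongr
      exact abs_eval_nodal_chebyshevNodes_le n hy
    _ = 2 * (2 ^ n * Real.Gamma ((n : ℝ) / 2 + 1))⁻¹ * σ ^ n := by
      have hd := Gamma_half_eq n
      have hf : (0 : ℝ) < n.factorial := by positivity
      generalize Real.Gamma ((n : ℝ) / 2 + 1) = b at *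
      rw [mul_pow]
      field_simp
      linear_combination σ ^ n * hd
    _ ≤ _ := by
      gcongr
      exact inv_Gamma_half_le n

/-! ### Eigenvalue bound from finite codimension -/

/-- Eigenspaces are mutually orthogonal, so the quadratic form is `∑ ν ‖w ν‖²` with every `ν ≥ μ`.
-/
theorem LinearMap.IsSymmetric.mul_norm_sq_le_inner_of_mem_iSup_eigenspace
    {E : Type*} [NormedAddCommGroup E] [InnerProductSpace ℝ E] {T : E →ₗ[ℝ] E}
    (hT : T.IsSymmetric) {μ : ℝ} {v : E}
    (hv : v ∈ ⨆ ν ∈ Set.Ici μ, Module.End.eigenspace T ν) :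
    μ * ‖v‖ ^ 2 ≤ inner ℝ (T v) v := by
  classical
  rw [iSup_subtype', Submodule.mem_iSup_iff_exists_finsupp] at hv
  obtain ⟨w, hw, rfl⟩ := hv
  have hV : OrthogonalFamily ℝ (fun ν : Set.Ici μ => Module.End.eigenspace T (ν : ℝ))
      fun ν => (Module.End.eigenspace T (ν : ℝ)).subtypeₗᵢ :=
    hT.orthogonalFamily_eigenspaces.comp Subtype.coe_injective
  have hTw (ν) : T (w ν) = (ν : ℝ) • w ν := Module.End.mem_eigenspace_iff.mp (hw ν)
  have h1 := hV.inner_sum (fun ν => ⟨w ν, hw ν⟩) (fun ν => ⟨w ν, hw ν⟩) w.support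
  have h2 := hV.inner_sum (fun ν => (ν : ℝ) • ⟨w ν, hw ν⟩) (fun ν => ⟨w ν, hw ν⟩) w.support
  simp only [Submodule.coe_subtypeₗᵢ, Submodule.subtype_apply, Submodule.coe_smul,
    Submodule.coe_inner] at h1 h2
  rw [← real_inner_self_eq_norm_sq, Finsupp.sum, map_sum]
  simp only [hTw]
  rw [h1, h2, Finset.mul_sum]
  refine Finset.sum_le_sum fun ν _ => ?_
  rw [real_inner_smul_left]
  exact mul_le_mul_of_nonneg_right ν.2 real_inner_self_nonneg

/-- If a symmetric operator satisfies `⟪T v, v⟫ ≤ B ‖v‖²` on the kernel of a map of rank less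
than `k`, then its `k`-th eigenvalue is at most `B`. -/
theorem LinearMap.IsSymmetric.orderedEigenvalue_le
    {E : Type*} [NormedAddCommGroup E] [InnerProductSpace ℝ E] {T : E →ₗ[ℝ] E}
    (hT : T.IsSymmetric) {ι : Type} [Fintype ι] {k : ℕ} (hk : Fintype.card ι < k)
    (L : E →ₗ[ℝ] (ι → ℝ)) {B : ℝ} (hB : 0 ≤ B)
    (h : ∀ v, L v = 0 → inner ℝ (T v) v ≤ B * ‖v‖ ^ 2) :
    orderedEigenvalue T k ≤ B := by
  -- `hB` covers the empty set, whose `sSup` is `0`.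
  refine Real.sSup_le ?_ hB
  rintro μ ⟨-, hμ⟩
  set W := ⨆ ν ∈ Set.Ici μ, Module.End.eigenspace T ν with hW
  have hni : ¬ Function.Injective (L.domRestrict W) := by
    intro hinj
    have h1 := LinearMap.lift_rank_le_of_injective _ hinj
    rw [rank_fun', Cardinal.lift_natCast] at h1
    have h2 := Cardinal.lift_le.mpr hμ
    rw [Cardinal.lift_natCast] at h2
    exact hk.not_ge (Nat.cast_le.mp (h2.trans h1))
  rw [← LinearMap.ker_eq_bot, Submodule.eq_bot_iff] at hni
  push Not at hni
  obtain ⟨v, hv, hv0⟩ := hni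
  have h1 := hT.mul_norm_sq_le_inner_of_mem_iSup_eigenspace v.2
  have h2 := h v hv
  have h3 : 0 < ‖(v : E)‖ := norm_pos_iff.mpr (by simpa using hv0)
  exact le_of_mul_le_mul_right (h1.trans h2) (by positivity)

/-! ### Application to the Gaussian operator -/

theorem gaussianKernel_comm (σ x y : ℝ) : gaussianKernel σ x y = gaussianKernel σ y x := by
  unfold gaussianKernel
  rw [← neg_sub y x, neg_sq]

theorem inner_gaussianOperator (σ : ℝ) (φ ψ : L2Interval) :
    inner ℝ (gaussianOperator σ φ) ψ =
      ∫ x, (∫ y, gaussianKernel σ x y * φ y ∂lebesgueInterval) * ψ x ∂lebesgueInterval := by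
  rw [L2.inner_def]
  refine integral_congr_ae ?_
  filter_upwards [(gaussianIntegral_memLp σ φ).coeFn_toLp] with x hx
  rw [real_inner_comm]
  simp only [gaussianOperator, LinearMap.coe_mk, AddHom.coe_mk, hx]
  simp [mul_comm]

theorem gaussianOperator_isSymmetric (σ : ℝ) : (gaussianOperator σ).IsSymmetric := by
  intro φ ψ
  rw [← real_inner_comm φ, inner_gaussianOperator, inner_gaussianOperator]
  simp_rw [← integral_mul_const]
  rw [integral_integral_swap]
  · simp_rw [gaussianKernel_comm σ, mul_right_comm]
  · have h := ((L2Interval_integrable ψ).mul_prod (L2Interval_integrable φ)).bdd_mul (c := 1)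
      (gaussianKernel_continuous σ).aestronglyMeasurable
      (Filter.Eventually.of_forall fun p => gaussianKernel_norm_le_one σ p.1 p.2)
    refine h.congr (Filter.Eventually.of_forall fun p => ?_)
    simp only [Function.uncurry]
    ring

/-- Cauchy–Schwarz, in the form that the variance of `|φ|` about its mean `I / 2` is nonnegative;
`2` is the interval's length. -/
theorem sq_integral_abs_le (φ : L2Interval) :
    (∫ y, |φ y| ∂lebesgueInterval) ^ 2 ≤ 2 * ‖φ‖ ^ 2 := by
  set I := ∫ y, |φ y| ∂lebesgueInterval with hI
  have hn : ‖φ‖ ^ 2 = ∫ y, φ y ^ 2 ∂lebesgueInterval := by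
    rw [← real_inner_self_eq_norm_sq, L2.inner_def]
    simp [sq]
  have h1 : Integrable (fun y => φ y ^ 2) lebesgueInterval := (Lp.memLp φ).integrable_sq
  have h2 : Integrable (fun y => |φ y|) lebesgueInterval := (L2Interval_integrable φ).abs
  have hvol : lebesgueInterval.real Set.univ = 2 := by
    simp [lebesgueInterval, Measure.real]
    norm_num
  have h3 : ∫ y, (|φ y| - I / 2) ^ 2 ∂lebesgueInterval = ‖φ‖ ^ 2 - I ^ 2 / 2 := by
    have : ∀ y, (|φ y| - I / 2) ^ 2 = φ y ^ 2 - I * |φ y| + I ^ 2 / 4 := by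
      intro y
      rw [sub_sq, sq_abs]
      ring
    simp_rw [this]
    have h3 : Integrable (fun y => φ y ^ 2 - I * |φ y|) lebesgueInterval :=
      h1.sub (h2.const_mul I)
    rw [integral_add h3 (integrable_const _),
      integral_sub h1 (h2.const_mul I), integral_const_mul, ← hI, ← hn, integral_const, hvol]
    simp only [smul_eq_mul]
    ring
  have h4 : 0 ≤ ∫ y, (|φ y| - I / 2) ^ 2 ∂lebesgueInterval :=
    integral_nonneg fun y => sq_nonneg _
  linarith

theorem memLp_polynomial_eval (p : Polynomial ℝ) :
    MemLp (fun y => p.eval y) 2 lebesgueInterval := by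
  obtain ⟨C, hC⟩ := isCompact_Icc.exists_bound_of_continuousOn
    (s := Set.Icc (-1 : ℝ) 1) p.continuous.continuousOn
  refine MemLp.of_bound p.continuous.aestronglyMeasurable C ?_
  exact (ae_restrict_iff' measurableSet_Icc).mpr (Filter.Eventually.of_forall hC)

/-- If every section `y ↦ K(x, y)` of the Gaussian kernel is within `M` of its interpolant at the
nodes `s`, then the eigenvalues of index larger than `#s` are at most `2 M`. -/
theorem orderedEigenvalue_gaussianOperator_le (σ : ℝ) (s : Finset ℝ) {k : ℕ} (hk : s.card < k)
    {M : ℝ} (hM0 : 0 ≤ M)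
    (hM : ∀ x, ∀ y ∈ Set.Icc (-1 : ℝ) 1, |gaussianKernel σ x y -
      (Lagrange.interpolate s id (gaussianKernel σ x)).eval y| ≤ M) :
    orderedEigenvalue (gaussianOperator σ) k ≤ 2 * M := by
  let b (i : ℝ) : L2Interval := (memLp_polynomial_eval (Lagrange.basis s id i)).toLp _
  refine (gaussianOperator_isSymmetric σ).orderedEigenvalue_le (ι := s) (by simpa using hk)
    (LinearMap.pi fun i => innerₛₗ ℝ (b i)) (by positivity) fun φ hφ => ?_
  have hbi (i : ℝ) : Integrable (fun y => (Lagrange.basis s id i).eval y * φ y)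
      lebesgueInterval :=
    (memLp_polynomial_eval (Lagrange.basis s id i)).integrable_mul (Lp.memLp φ)
  have hb (i : ℝ) (hi : i ∈ s) :
      ∫ y, (Lagrange.basis s id i).eval y * φ y ∂lebesgueInterval = 0 := by
    have h1 : inner ℝ (b i) φ = 0 := congrFun hφ ⟨i, hi⟩
    rw [← h1, L2.inner_def]
    refine integral_congr_ae ?_
    filter_upwards [(memLp_polynomial_eval (Lagrange.basis s id i)).coeFn_toLp] with y hy
    simp [b, hy, mul_comm]
  have hexp (x y : ℝ) : (Lagrange.interpolate s id (gaussianKernel σ x)).eval y * φ y =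
      ∑ i ∈ s, gaussianKernel σ x i * ((Lagrange.basis s id i).eval y * φ y) := by
    rw [Lagrange.interpolate_apply, Polynomial.eval_finsetSum, Finset.sum_mul]
    simp [mul_assoc]
  have hPi (x : ℝ) : Integrable
      (fun y => (Lagrange.interpolate s id (gaussianKernel σ x)).eval y * φ y)
      lebesgueInterval :=
    (memLp_polynomial_eval _).integrable_mul (Lp.memLp φ)
  have hP (x : ℝ) : ∫ y, (Lagrange.interpolate s id (gaussianKernel σ x)).eval y * φ y
      ∂lebesgueInterval = 0 := by
    simp_rw [hexp]
    rw [integral_finsetSum _ fun i _ => (hbi i).const_mul _]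
    refine Finset.sum_eq_zero fun i hi => ?_
    rw [integral_const_mul, hb i hi, mul_zero]
  set I := ∫ y, |φ y| ∂lebesgueInterval with hI
  have habs : Integrable (fun y => |φ y|) lebesgueInterval := (L2Interval_integrable φ).abs
  have hT (x : ℝ) : |∫ y, gaussianKernel σ x y * φ y ∂lebesgueInterval| ≤ M * I := by
    rw [← sub_zero (∫ y, gaussianKernel σ x y * φ y ∂lebesgueInterval), ← hP x,
      ← integral_sub (gaussianKernel_mul_integrable σ x φ) (hPi x), hI, ← integral_const_mul,
      ← Real.norm_eq_abs]
    refine norm_integral_le_of_norm_le (habs.const_mul M) ?_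
    refine (ae_restrict_iff' measurableSet_Icc).mpr (Filter.Eventually.of_forall ?_)
    intro y hy
    rw [← sub_mul, Real.norm_eq_abs, abs_mul]
    exact mul_le_mul_of_nonneg_right (hM x y hy) (abs_nonneg _)
  calc inner ℝ (gaussianOperator σ φ) φ ≤ ‖inner ℝ (gaussianOperator σ φ) φ‖ :=
        Real.le_norm_self _
    _ ≤ ∫ x, M * I * |φ x| ∂lebesgueInterval := by
        rw [inner_gaussianOperator]
        refine norm_integral_le_of_norm_le (habs.const_mul _)
          (Filter.Eventually.of_forall fun x => ?_)
        rw [Real.norm_eq_abs, abs_mul]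
        exact mul_le_mul_of_nonneg_right (hT x) (abs_nonneg _)
    _ = M * I ^ 2 := by rw [integral_const_mul, ← hI]; ring
    _ ≤ M * (2 * ‖φ‖ ^ 2) := mul_le_mul_of_nonneg_left (sq_integral_abs_le φ) hM0
    _ = 2 * M * ‖φ‖ ^ 2 := by ring

theorem mainTheorem7 (σ : ℝ) (hσ : 0 < σ) (k : ℕ) (hk : 1 ≤ k) :
    orderedEigenvalue (gaussianOperator σ) k <
      8 * (2 / Real.exp 1 * ((k : ℝ) - 1)) ^ (-((k : ℝ) - 1) / 2) * σ ^ (k - 1) := by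
  obtain ⟨n, rfl⟩ : ∃ n, k = n + 1 := ⟨k - 1, by omega⟩
  simp only [Nat.cast_add, Nat.cast_one, add_sub_cancel_right, Nat.add_sub_cancel]
  set M := 2 * (2 / Real.exp 1 * (n : ℝ)) ^ (-(n : ℝ) / 2) * σ ^ n with hM
  have hM0 : 0 < M := by
    rcases n.eq_zero_or_pos with rfl | hn
    · simp [hM]
    · positivity
  have h := orderedEigenvalue_gaussianOperator_le σ (chebyshevNodes n) (k := n + 1)
    (by rw [card_chebyshevNodes]; exact n.lt_succ_self) hM0.le
    (fun x y hy => abs_gaussianKernel_sub_chebyshev_le hσ.le n x hy)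
  -- `2 * M` carries the constant `4`, so `M > 0` makes the bound with `8` strict.
  linarith
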